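/- Let $\Bbbk$ be a commutative noetherian ring, let $G$ be a free group (of arbitrary, possibly infinite, rank), and let $\Bbbk[G]$ be its group algebra. Then for every $n$ the matrix algebra $M_n(\Bbbk[G])$ of $n\times n$ matrices with entries in $\Bbbk[G]$ is both left and right coherent. Here a left module $M$ over a ring $A$ is called coherent if it is finitely generated and, for every $A$-linear map $\varphi : P\to M$ with $P$ a free module of finite rank, the kernel of $\varphi$ is finitely generated; right coherent modules are defined in the same way. A ring $A$ is left (right) coherent if it is coherent as a left (right) module over itself. -/

import Mathlib

/-- A (left) module `M` over a ring `A` is coherent if it is finitely generated and every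
`A`-linear map from a free module of finite rank to `M` has finitely generated kernel. -/
def IsCoherentModule (A : Type*) (M : Type*) [Ring A] [AddCommGroup M] [Module A M] : Prop :=
  Module.Finite A M ∧ ∀ (n : ℕ) (φ : (Fin n → A) →ₗ[A] M), (LinearMap.ker φ).FG

/-- A ring is left coherent if it is coherent as a left module over itself. -/
def IsLeftCoherentRing (A : Type*) [Ring A] : Prop :=
  IsCoherentModule A A

/-- A ring is right coherent if it is coherent as a right module over itself; right `A`-modules
are left modules over the opposite ring, which acts on `A` by `MulOpposite.op a • x = x * a`. -/
def IsRightCoherentRing (A : Type*) [Ring A] : Prop :=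
  IsCoherentModule Aᵐᵒᵖ A

/-! It suffices that maps φ between finite free left modules over `k[G]` have finitely generated
kernels. This property passes to finite free extensions, hence to matrix rings, and the opposite of
`k[G]` is again a group algebra of a free group. The matrix of φ involves finitely many generators,
so decomposing vectors along cosets reduces to finite rank.

There the Cayley graph is a tree. Cut a kernel element x along the branch at g: φ of the piece lives
near g, being also minus φ of the rest (`map_piRestrict_branch_mem`). Translated to the identity,
branches fall into finitely many cones, and since k is noetherian these local values are attained on
a bounded part of the cone (`exists_bounded_preimage`). Exchanging deep pieces for such bounded ones
shrinks x modulo kernel elements of bounded support (`exists_ker_le_span`). -/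

namespace FreeGroup

/-! ### Cancellation of reduced words and branches of the Cayley tree. -/

variable {α : Type*}

/-- Two reduced words multiply by cancelling a suffix of the first against a prefix of the
second. -/
lemma IsReduced.exists_cancellation {L₁ L₂ : List (α × Bool)} (h₁ : IsReduced L₁)
    (h₂ : IsReduced L₂) :
    ∃ p c q, L₁ = p ++ c ∧ L₂ = invRev c ++ q ∧ IsReduced (p ++ q) := by
  induction L₂ generalizing L₁ with
  | nil => exact ⟨L₁, [], [], by simp, by simp [invRev], by simpa using h₁⟩
  | cons s L ih =>
    by_cases hred : IsReduced (L₁ ++ s :: L)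
    · exact ⟨L₁, [], s :: L, by simp, by simp [invRev], hred⟩
    · obtain rfl | ⟨L', t, rfl⟩ : L₁ = [] ∨ ∃ L' t, L₁ = L' ++ [t] := by
        simpa using List.eq_nil_or_concat L₁
      · exact absurd h₂ hred
      · simp only [IsReduced, List.isChain_append] at hred h₁
        have hts : t.1 = s.1 ∧ t.2 ≠ s.2 := by
          by_contra hcon
          refine hred ⟨h₁, h₂, ?_⟩
          simpa using hcon
        obtain ⟨p, c, q, rfl, rfl, hpq⟩ := ih h₁.1 h₂.tail
        refine ⟨p, c ++ [t], q, by simp, ?_, hpq⟩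
        have : s = (t.1, !t.2) := by
          ext
          · exact hts.1.symm
          · have := hts.2
            cases h1 : t.2 <;> cases h2 : s.2 <;> simp_all
        simp [invRev, this]

variable [DecidableEq α]

/-- The elements whose reduced word starts with the reduced word of `g`. -/
def branch (g : FreeGroup α) : Set (FreeGroup α) := {w | g.toWord <+: w.toWord}

lemma toWord_inv_mul_of_append {g w : FreeGroup α} {t : List (α × Bool)}
    (h : g.toWord ++ t = w.toWord) : (g⁻¹ * w).toWord = t := by
  have hw : w = g * mk t := by
    rw [← mk_toWord (x := w), ← h, ← mul_mk, mk_toWord]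
  have ht : IsReduced t := (isReduced_toWord (x := w)).infix ⟨g.toWord, [], by simp [h]⟩
  rw [hw, inv_mul_cancel_left, toWord_mk, ht.reduce_eq]

/-- Right multiplication by `b` leaves the branch of `g` only close to `g`. -/
lemma norm_inv_mul_le_of_mul_notMem_branch {g w b : FreeGroup α} (hw : w ∈ branch g)
    (hb : w * b ∉ branch g) : norm (g⁻¹ * w) ≤ norm b := by
  obtain ⟨t, ht⟩ := hw
  obtain ⟨p, c, q, h₁, h₂, h₃⟩ :=
    (isReduced_toWord (x := w)).exists_cancellation (isReduced_toWord (x := b))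
  have hwb : (w * b).toWord = p ++ q := by
    have : w * b = mk (p ++ q) := by
      rw [← mk_toWord (x := w), ← mk_toWord (x := b), h₁, h₂, ← mul_mk, ← mul_mk, ← mul_mk,
        ← inv_mk]
      group
    rw [this, toWord_mk, h₃.reduce_eq]
  have hc : c.length ≤ norm b := by
    simp [norm, h₂]
  -- At most `norm b` letters cancel; if the part `t` of `w` beyond `g` is longer, the prefix `g`
  -- survives.
  by_contra! hlt
  have hlen : norm (g⁻¹ * w) = t.length := by rw [norm, toWord_inv_mul_of_append ht]
  apply hb
  have hle : g.toWord.length ≤ p.length := by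
    have := congrArg List.length (ht.trans h₁)
    simp only [List.length_append] at this
    omega
  have : g.toWord <+: p :=
    List.prefix_of_prefix_length_le ⟨t, ht⟩ ⟨c, h₁.symm⟩ hle
  change _ <+: _
  rw [hwb]
  exact this.trans (List.prefix_append _ _)

/-- The elements whose reduced word may follow the letter `c` without cancellation. -/
def followers (c : Option (α × Bool)) : Set (FreeGroup α) :=
  {p | ∀ a ∈ c, ∀ b ∈ p.toWord.head?, a.1 = b.1 → a.2 = b.2}

lemma toWord_mul_of_mem_followers {g p : FreeGroup α} (hp : p ∈ followers g.toWord.getLast?) :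
    (g * p).toWord = g.toWord ++ p.toWord := by
  rw [toWord_mul, IsReduced.reduce_eq]
  exact List.isChain_append.2 ⟨isReduced_toWord, isReduced_toWord, hp⟩

lemma norm_mul_of_mem_followers {g p : FreeGroup α} (hp : p ∈ followers g.toWord.getLast?) :
    norm (g * p) = norm g + norm p := by
  simp [norm, toWord_mul_of_mem_followers hp]

/-- The target depends only on the last letter of `g`, so finitely many generators give finitely
many cones and bounds uniform in `g`. -/
lemma inv_mul_mem_followers {g w : FreeGroup α} (hw : w ∈ branch g) :
    g⁻¹ * w ∈ followers g.toWord.getLast? := by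
  obtain ⟨t, ht⟩ := hw
  have h : IsReduced (g.toWord ++ t) := ht ▸ isReduced_toWord
  rw [followers, Set.mem_ofPred_eq, toWord_inv_mul_of_append ht]
  exact (List.isChain_append.1 h).2.2

/-- Together with `eq_of_mem_branch`: the branches at depth `n` partition the elements of norm at
least `n`. -/
lemma exists_mem_branch (w : FreeGroup α) {n : ℕ} (hn : n ≤ norm w) :
    ∃ g, norm g = n ∧ w ∈ branch g := by
  have h : (mk (w.toWord.take n)).toWord = w.toWord.take n := by
    rw [toWord_mk, IsReduced.reduce_eq]
    exact (isReduced_toWord (x := w)).infix (List.take_prefix _ _).isInfix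
  refine ⟨mk (w.toWord.take n), ?_, ?_⟩
  · rw [norm, h, List.length_take]
    exact min_eq_left hn
  · change _ <+: _
    rw [h]
    exact List.take_prefix _ _

lemma eq_of_mem_branch {w g g' : FreeGroup α} (h : w ∈ branch g) (h' : w ∈ branch g')
    (hn : norm g = norm g') : g = g' := by
  apply toWord_injective
  exact (List.prefix_of_prefix_length_le h h' hn.le).eq_of_length hn

lemma finite_norm_le [Finite α] (n : ℕ) : {g : FreeGroup α | norm g ≤ n}.Finite :=
  (List.finite_length_le (α × Bool) n).preimage toWord_injective.injOn

end FreeGroup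

/-! ### Supports of vectors over a group algebra. -/

namespace MonoidAlgebra

open scoped Pointwise

variable {k G ι κ : Type*} [CommRing k]

section Supported

variable (k ι) in
/-- The vectors over the monoid algebra all of whose entries are supported on `S`. -/
noncomputable def piSupported (S : Set G) : Submodule k (ι → MonoidAlgebra k G) :=
  Submodule.pi Set.univ fun _ => supported k k S

lemma mem_piSupported {S : Set G} {x : ι → MonoidAlgebra k G} :
    x ∈ piSupported k ι S ↔ ∀ i, ∀ g ∉ S, (x i).coeff g = 0 := by
  simp [piSupported, Submodule.mem_pi, mem_supported']

lemma piSupported_mono {S T : Set G} (h : S ⊆ T) : piSupported k ι S ≤ piSupported k ι T :=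
  fun _ hx => mem_piSupported.2 fun i g hg => mem_piSupported.1 hx i g fun hS => hg (h hS)

lemma mem_piSupported_inter {S T : Set G} {x : ι → MonoidAlgebra k G}
    (hS : x ∈ piSupported k ι S) (hT : x ∈ piSupported k ι T) : x ∈ piSupported k ι (S ∩ T) := by
  refine mem_piSupported.2 fun i g hg => ?_
  by_cases h : g ∈ S
  · exact mem_piSupported.1 hT i g fun h' => hg ⟨h, h'⟩
  · exact mem_piSupported.1 hS i g h

lemma exists_finset_mem_piSupported [Finite ι] (x : ι → MonoidAlgebra k G) :
    ∃ F : Finset G, x ∈ piSupported k ι (F : Set G) := by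
  classical
  cases nonempty_fintype ι
  refine ⟨Finset.univ.biUnion fun i => (x i).coeff.support, mem_piSupported.2 fun i g hg => ?_⟩
  by_contra h
  exact hg (Finset.mem_coe.2 (Finset.mem_biUnion.2
    ⟨i, Finset.mem_univ _, Finsupp.mem_support_iff.2 h⟩))

instance isNoetherian_piSupported [IsNoetherianRing k] [Finite ι] (S : Set G) [Finite S] :
    IsNoetherian k (piSupported k ι S) := by
  let f : piSupported k ι S →ₗ[k] (ι → S → k) :=
    { toFun := fun x i s => (x.1 i).coeff s
      map_add' := fun _ _ => rfl
      map_smul' := fun _ _ => rfl }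
  refine isNoetherian_of_injective f fun x y h => ?_
  ext i g
  by_cases hg : g ∈ S
  · exact congrFun (congrFun h i) ⟨g, hg⟩
  · rw [mem_piSupported.1 x.2 i g hg, mem_piSupported.1 y.2 i g hg]

open Classical in
/-- The part of a vector supported on `S`. -/
noncomputable def piRestrict (S : Set G) (x : ι → MonoidAlgebra k G) : ι → MonoidAlgebra k G :=
  fun i => ofCoeff ((x i).coeff.filter (· ∈ S))

open Classical in
lemma coeff_piRestrict (S : Set G) (x : ι → MonoidAlgebra k G) (i : ι) (g : G) :
    (piRestrict S x i).coeff g = if g ∈ S then (x i).coeff g else 0 := by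
  simp [piRestrict, Finsupp.filter_apply]

lemma piRestrict_mem (S : Set G) (x : ι → MonoidAlgebra k G) :
    piRestrict S x ∈ piSupported k ι S :=
  mem_piSupported.2 fun i g hg => by simp [coeff_piRestrict, hg]

lemma piRestrict_mem_of_mem {S T : Set G} {x : ι → MonoidAlgebra k G}
    (hx : x ∈ piSupported k ι T) : piRestrict S x ∈ piSupported k ι T :=
  mem_piSupported.2 fun i g hg => by simp [coeff_piRestrict, mem_piSupported.1 hx i g hg]

lemma piRestrict_add_piRestrict_compl (S : Set G) (x : ι → MonoidAlgebra k G) :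
    piRestrict S x + piRestrict Sᶜ x = x := by
  ext i g
  by_cases hg : g ∈ S <;> simp [coeff_piRestrict, hg]

lemma single_smul_mem_piSupported [Group G] (g : G) {S T : Set G} {x : ι → MonoidAlgebra k G}
    (hx : x ∈ piSupported k ι S) (h : ∀ s ∈ S, g * s ∈ T) :
    (single g (1 : k) : MonoidAlgebra k G) • x ∈ piSupported k ι T := by
  refine mem_piSupported.2 fun i t ht => ?_
  rw [Pi.smul_apply, smul_eq_mul, coeff_single_mul_apply, one_mul]
  exact mem_piSupported.1 hx i _ fun hs => ht (by simpa using h _ hs)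

end Supported

section Propagation

variable [Group G]

/-- A linear map between free modules of finite rank over a group algebra moves supports by
right multiplication with a fixed finite set. -/
lemma exists_finset_map_mem_piSupported [Fintype ι] [Finite κ]
    (φ : (ι → MonoidAlgebra k G) →ₗ[MonoidAlgebra k G] (κ → MonoidAlgebra k G)) :
    ∃ F : Finset G, ∀ S : Set G, ∀ x ∈ piSupported k ι S,
      φ x ∈ piSupported k κ (S * (F : Set G)) := by
  classical
  choose F hF using fun i => exists_finset_mem_piSupported (φ fun j => if i = j then 1 else 0)
  refine ⟨Finset.univ.biUnion F, fun S x hx => ?_⟩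
  rw [LinearMap.pi_apply_eq_sum_univ φ x]
  refine Submodule.sum_mem _ fun i _ => ?_
  refine mem_piSupported.2 fun j g hg => ?_
  by_contra hne
  have hmem := support_coeff_mul_subset (x i) (φ (fun j => if i = j then 1 else 0) j)
    (Finsupp.mem_support_iff.2 hne)
  obtain ⟨s, hs, f, hf, rfl⟩ := Finset.mem_mul.1 hmem
  refine hg (Set.mul_mem_mul ?_ ?_)
  · by_contra h
    exact Finsupp.mem_support_iff.1 hs (mem_piSupported.1 hx i s h)
  · refine Finset.mem_coe.2 (Finset.mem_biUnion.2 ⟨i, Finset.mem_univ _, ?_⟩)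
    by_contra h
    exact Finsupp.mem_support_iff.1 hf (mem_piSupported.1 (hF i) j f h)

end Propagation

/-! ### Kernels over free groups of finite rank. -/

section FreeGroup

open FreeGroup hiding norm

variable {α : Type*} [DecidableEq α]
  {φ : (ι → MonoidAlgebra k (FreeGroup α)) →ₗ[MonoidAlgebra k (FreeGroup α)]
    (κ → MonoidAlgebra k (FreeGroup α))}

/-- The part of a kernel element in a branch is mapped to a neighbourhood of the root of that
branch. -/
lemma map_piRestrict_branch_mem {F : Finset (FreeGroup α)} {r : ℕ} (hr : ∀ f ∈ F, FreeGroup.norm f ≤ r)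
    (hF : ∀ S : Set (FreeGroup α), ∀ x ∈ piSupported k ι S,
      φ x ∈ piSupported k κ (S * (F : Set (FreeGroup α))))
    {x : ι → MonoidAlgebra k (FreeGroup α)} (hx : φ x = 0) (g : FreeGroup α) :
    φ (piRestrict (branch g) x) ∈ piSupported k κ {h | FreeGroup.norm (g⁻¹ * h) ≤ 2 * r} := by
  have h₁ := hF _ _ (piRestrict_mem (branch g) x)
  have h₂ : φ (piRestrict (branch g) x) ∈ piSupported k κ ((branch g)ᶜ * (F : Set _)) := by
    have : φ (piRestrict (branch g) x) = -φ (piRestrict (branch g)ᶜ x) := by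
      rw [eq_neg_iff_add_eq_zero, ← map_add, piRestrict_add_piRestrict_compl, hx]
    rw [this]
    exact Submodule.neg_mem _ (hF _ _ (piRestrict_mem _ x))
  refine piSupported_mono ?_ (mem_piSupported_inter h₁ h₂)
  rintro h ⟨⟨w, hw, b, hb, rfl⟩, ⟨u, hu, b', hb', hub⟩⟩
  change u * b' = w * b at hub
  have hb := hr b hb
  have hb' := hr b' hb'
  change FreeGroup.norm (g⁻¹ * (w * b)) ≤ 2 * r
  -- The branch is left either by `b'⁻¹` from `w * b`, which is then within `r` of `g`, or already
  -- by `b` from `w`, which puts `w * b` within `2 * r`.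
  by_cases hwb : w * b ∈ branch g
  · have : w * b * b'⁻¹ ∉ branch g := by
      rwa [← hub, mul_inv_cancel_right]
    have := norm_inv_mul_le_of_mul_notMem_branch hwb this
    rw [norm_inv_eq] at this
    omega
  · have h₃ := norm_inv_mul_le_of_mul_notMem_branch hw hwb
    have h₄ := norm_mul_le (g⁻¹ * w) b
    rw [mul_assoc] at h₄
    omega

/-- Local values of a linear map on `U` are attained on bounded parts of `U`. -/
lemma exists_bounded_preimage [IsNoetherianRing k] [Finite α] [Finite ι] [Finite κ]
    (φ : (ι → MonoidAlgebra k (FreeGroup α)) →ₗ[MonoidAlgebra k (FreeGroup α)]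
      (κ → MonoidAlgebra k (FreeGroup α)))
    (U : Set (FreeGroup α)) (R : ℕ) :
    ∃ D : ℕ, ∀ x ∈ piSupported k ι U, φ x ∈ piSupported k κ {h | FreeGroup.norm h ≤ R} →
      ∃ y ∈ piSupported k ι (U ∩ {h | FreeGroup.norm h ≤ D}), φ y = φ x := by
  have := (finite_norm_le (α := α) R).to_subtype
  let ψ := φ.restrictScalars k
  let Q := (piSupported k ι U).map ψ ⊓ piSupported k κ {h | FreeGroup.norm h ≤ R}
  -- Values in a finite ball form a noetherian `k`-module, so finitely many preimages decide the
  -- radius `D`.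
  have hQ : Q.FG := (isNoetherian_submodule.1 (isNoetherian_piSupported _)) Q inf_le_right
  obtain ⟨s, hs⟩ := hQ
  have hsQ : ∀ z ∈ s, ∃ D : ℕ, z ∈ (piSupported k ι (U ∩ {h | FreeGroup.norm h ≤ D})).map ψ := by
    intro z hz
    obtain ⟨y, hy, rfl⟩ := (hs ▸ Submodule.subset_span hz : z ∈ Q).1
    obtain ⟨F, hF⟩ := exists_finset_mem_piSupported y
    refine ⟨F.sup FreeGroup.norm, y, mem_piSupported_inter hy (piSupported_mono ?_ hF), rfl⟩
    exact fun f hf => Finset.le_sup (f := FreeGroup.norm) hf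
  choose! D hD using hsQ
  refine ⟨s.sup D, fun x hx hφ => ?_⟩
  have hmem : ψ x ∈ Q := ⟨⟨x, hx, rfl⟩, hφ⟩
  have hle : Q ≤ (piSupported k ι (U ∩ {h | FreeGroup.norm h ≤ s.sup D})).map ψ := by
    rw [← hs, Submodule.span_le]
    intro z hz
    refine Submodule.map_mono (piSupported_mono ?_) (hD z hz)
    exact Set.inter_subset_inter_right _ fun h (hh : FreeGroup.norm h ≤ D z) =>
      hh.trans (Finset.le_sup (f := D) hz)
  obtain ⟨y, hy, hyx⟩ := hle hmem
  exact ⟨y, hy, hyx⟩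

/-- The kernel of a linear map between free modules of finite rank over the group algebra of a
free group of finite rank is generated by elements of bounded support. -/
lemma exists_ker_le_span [IsNoetherianRing k] [Finite α] [Fintype ι] [Finite κ]
    (φ : (ι → MonoidAlgebra k (FreeGroup α)) →ₗ[MonoidAlgebra k (FreeGroup α)]
      (κ → MonoidAlgebra k (FreeGroup α))) :
    ∃ L : ℕ, LinearMap.ker φ ≤ Submodule.span (MonoidAlgebra k (FreeGroup α))
      {x | φ x = 0 ∧ x ∈ piSupported k ι {h | FreeGroup.norm h ≤ L}} := by
  obtain ⟨F, hF⟩ := exists_finset_map_mem_piSupported φ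
  choose D hD using fun c => exists_bounded_preimage φ (followers (α := α) c) (2 * F.sup FreeGroup.norm)
  cases nonempty_fintype α
  let D₀ := Finset.univ.sup D
  -- Chosen so that `(N + 1 - L) + D₀ = N` once `L ≤ N + 1`: replacements rooted at depth `N + 1 -
  -- L` stay in the ball of radius `N`.
  let L := D₀ + 1
  refine ⟨L, ?_⟩
  set K := Submodule.span (MonoidAlgebra k (FreeGroup α))
      {x | φ x = 0 ∧ x ∈ piSupported k ι {h | FreeGroup.norm h ≤ L}}
  have key : ∀ N : ℕ, ∀ x, φ x = 0 → x ∈ piSupported k ι {h | FreeGroup.norm h ≤ N} → x ∈ K := by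
    intro N
    induction N with
    | zero =>
      exact fun x hx hN => Submodule.subset_span ⟨hx, piSupported_mono
        (fun h (hh : FreeGroup.norm h ≤ 0) => hh.trans (Nat.zero_le L)) hN⟩
    | succ N ih =>
      intro x hx hN
      by_cases hNL : N + 1 ≤ L
      · exact Submodule.subset_span ⟨hx, piSupported_mono
          (fun h (hh : FreeGroup.norm h ≤ N + 1) => hh.trans hNL) hN⟩
      have hy : ∀ g : FreeGroup α, FreeGroup.norm g = N + 1 - L → ∃ y ∈ piSupported k ι {h | FreeGroup.norm h ≤ N},
          piRestrict (branch g) x - y ∈ K ∧ φ (piRestrict (branch g) x - y) = 0 := by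
        intro g hg
        let u : MonoidAlgebra k (FreeGroup α) := single g 1
        let u' : MonoidAlgebra k (FreeGroup α) := single g⁻¹ 1
        have huu : u * u' = 1 := by simp [u, u', one_def]
        let x' := u' • piRestrict (branch g) x
        have hx' : x' ∈ piSupported k ι (followers g.toWord.getLast?) :=
          single_smul_mem_piSupported _ (piRestrict_mem _ _) fun w hw =>
            inv_mul_mem_followers hw
        have hφx' : φ x' ∈ piSupported k κ {h | FreeGroup.norm h ≤ 2 * F.sup FreeGroup.norm} := by
          rw [map_smul]
          exact single_smul_mem_piSupported _ (map_piRestrict_branch_mem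
            (fun f hf => Finset.le_sup (f := FreeGroup.norm) hf) hF hx g) fun w hw => hw
        obtain ⟨y, hy, hyx⟩ := hD _ x' hx' hφx'
        have hDle : D g.toWord.getLast? ≤ D₀ := Finset.le_sup (f := D) (Finset.mem_univ _)
        have hux : u • x' = piRestrict (branch g) x := by rw [smul_smul, huu, one_smul]
        refine ⟨u • y, single_smul_mem_piSupported _ hy ?_, ?_, ?_⟩
        · rintro p ⟨hp, hpD⟩
          change FreeGroup.norm _ ≤ N
          rw [norm_mul_of_mem_followers hp]
          have : FreeGroup.norm p ≤ D g.toWord.getLast? := hpD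
          omega
        · rw [← hux, ← smul_sub]
          refine Submodule.smul_mem _ _ (Submodule.subset_span ⟨by rw [map_sub, hyx, sub_self], ?_⟩)
          refine Submodule.sub_mem _ ?_ (piSupported_mono ?_ hy)
          · have h₁ : x' ∈ piSupported k ι {h | FreeGroup.norm (g * h) ≤ N + 1} :=
              single_smul_mem_piSupported _ (piRestrict_mem_of_mem hN) fun w hw => by
                simpa using hw
            -- Norms add on the cone, so `norm p ≤ (N + 1) - (N + 1 - L) = L`.
            refine piSupported_mono ?_ (mem_piSupported_inter hx' h₁)
            rintro p ⟨hp, hp' : FreeGroup.norm (g * p) ≤ N + 1⟩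
            rw [norm_mul_of_mem_followers hp] at hp'
            change FreeGroup.norm p ≤ L
            omega
          · rintro p ⟨_, hp : FreeGroup.norm p ≤ _⟩
            change FreeGroup.norm p ≤ L
            omega
        · rw [← hux, ← smul_sub, map_smul, map_sub, hyx, sub_self, smul_zero]
      choose! y hyN hyK hyφ using hy
      have hfin : {g : FreeGroup α | FreeGroup.norm g = N + 1 - L}.Finite :=
        (finite_norm_le (N + 1 - L)).subset fun g hg => le_of_eq hg
      set s := hfin.toFinset
      have hs : ∀ g ∈ s, FreeGroup.norm g = N + 1 - L := fun g hg => hfin.mem_toFinset.1 hg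
      have hsK : ∑ g ∈ s, (piRestrict (branch g) x - y g) ∈ K :=
        Submodule.sum_mem _ fun g hg => hyK g (hs g hg)
      have hrest : x - ∑ g ∈ s, (piRestrict (branch g) x - y g) ∈ K := by
        refine ih _ ?_ ?_
        · rw [map_sub, hx, map_sum, Finset.sum_eq_zero fun g hg => hyφ g (hs g hg), sub_zero]
        -- Each `p` of norm above `N` lies in exactly one of the branches, so removing all of them
        -- kills its coefficient.
        · rw [Finset.sum_sub_distrib, ← sub_add]
          refine Submodule.add_mem _ (mem_piSupported.2 fun i p hp => ?_)
            (Submodule.sum_mem _ fun g hg => hyN g (hs g hg))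
          have hp : N < FreeGroup.norm p := by simpa using hp
          obtain ⟨g, hg, hpg⟩ := exists_mem_branch p (n := N + 1 - L) (by omega)
          have hgs : g ∈ s := hfin.mem_toFinset.2 hg
          rw [Pi.sub_apply, coeff_sub, Finset.sum_apply, coeff_sum, Finsupp.sub_apply,
            Finsupp.finsetSum_apply, Finset.sum_eq_single_of_mem g hgs]
          · simp [coeff_piRestrict, hpg]
          · intro g' hg' hne
            rw [coeff_piRestrict, if_neg]
            exact fun h => hne (eq_of_mem_branch h hpg ((hs g' hg').trans hg.symm))
      simpa using Submodule.add_mem _ hrest hsK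
  intro x hx
  obtain ⟨S, hS⟩ := exists_finset_mem_piSupported x
  exact key (S.sup FreeGroup.norm) x hx (piSupported_mono
    (fun f hf => Finset.le_sup (f := FreeGroup.norm) hf) hS)

/-- The kernel elements supported in a finite ball form a finitely generated `k`-module, and they
span the kernel over the group algebra. -/
lemma ker_fg_of_finite_rank [IsNoetherianRing k] [Finite α] [Fintype ι] [Finite κ]
    (φ : (ι → MonoidAlgebra k (FreeGroup α)) →ₗ[MonoidAlgebra k (FreeGroup α)]
      (κ → MonoidAlgebra k (FreeGroup α))) :
    (LinearMap.ker φ).FG := by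
  obtain ⟨L, hL⟩ := exists_ker_le_span φ
  have := (finite_norm_le (α := α) L).to_subtype
  let Q := LinearMap.ker (φ.restrictScalars k) ⊓ piSupported k ι {h | FreeGroup.norm h ≤ L}
  obtain ⟨s, hs⟩ : Q.FG := (isNoetherian_submodule.1 (isNoetherian_piSupported _)) Q inf_le_right
  refine ⟨s, le_antisymm (Submodule.span_le.2 fun z hz => ?_) (hL.trans (Submodule.span_le.2 ?_))⟩
  · exact (hs ▸ Submodule.subset_span hz : z ∈ Q).1
  · intro z hz
    have : z ∈ Submodule.span k (s : Set (ι → MonoidAlgebra k (FreeGroup α))) := hs ▸ hz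
    exact Submodule.span_le_restrictScalars k (MonoidAlgebra k (FreeGroup α)) _ this

end FreeGroup

end MonoidAlgebra

/-! ### Passage from finite to arbitrary rank. -/

namespace MonoidAlgebra

variable {k G H ι κ : Type*} [CommRing k] [Group G] [Group H]

/-- The coefficients of an element of `k[G]` along the translate by `t` of the image of an
injective homomorphism `H →* G`. -/
noncomputable def translateComap (f : H →* G) (hf : Function.Injective f) (t : G) :
    MonoidAlgebra k G →+ MonoidAlgebra k H where
  toFun x := ofCoeff (x.coeff.comapDomain (fun h => t * f h)
    ((mul_right_injective t).comp hf).injOn)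
  map_zero' := by ext; simp
  map_add' _ _ := by ext; simp

variable (f : H →* G) (hf : Function.Injective f)

lemma coeff_translateComap (t : G) (x : MonoidAlgebra k G) (h : H) :
    (translateComap f hf t x).coeff h = x.coeff (t * f h) := by
  simp [translateComap]

/-- Right multiplication by the subgroup preserves each left coset, so taking the component along a
coset is right `k[H]`-linear. -/
lemma translateComap_mul (t : G) (x : MonoidAlgebra k G) (m : MonoidAlgebra k H) :
    translateComap f hf t (x * mapDomainRingHom k f m) = translateComap f hf t x * m := by
  induction m using MonoidAlgebra.induction_linear with
  | zero => simp
  | add a b ha hb => simp only [map_add, mul_add, ha, hb]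
  | single h c =>
    ext h'
    simp [coeff_translateComap, mul_assoc]

lemma coeff_mapDomain_translateComap (t g : G) (x : MonoidAlgebra k G) [Decidable (g ∈ f.range)] :
    (mapDomainRingHom k f (translateComap f hf t x)).coeff g =
      if g ∈ f.range then x.coeff (t * g) else 0 := by
  rw [mapDomainRingHom_apply, coeff_mapDomain]
  split_ifs with hg
  · obtain ⟨h, rfl⟩ := hg
    rw [Finsupp.mapDomain_apply hf, coeff_translateComap]
  · exact Finsupp.mapDomain_of_notMem_range _ _ hg

lemma mem_range_mapDomainRingHom (f : H →* G) (hf : Function.Injective f) {x : MonoidAlgebra k G}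
    (hx : ∀ g ∈ x.coeff.support, g ∈ f.range) : ∃ m, mapDomainRingHom k f m = x := by
  classical
  refine ⟨translateComap f hf 1 x, ?_⟩
  ext g
  rw [coeff_mapDomain_translateComap]
  split_ifs with h
  · rw [one_mul]
  · by_contra hne
    exact h (hx g (Finsupp.mem_support_iff.2 (Ne.symm hne)))

/-- A vector over `k[G]` is the sum of its components along the cosets of a subgroup. -/
lemma exists_eq_sum_translate [Finite ι] (x : ι → MonoidAlgebra k G) :
    ∃ s : Finset G, x = ∑ t ∈ s, (single t (1 : k) : MonoidAlgebra k G) •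
      fun i => mapDomainRingHom k f (translateComap f hf t (x i)) := by
  classical
  obtain ⟨F, hF⟩ := exists_finset_mem_piSupported x
  -- Canonical representatives ensure that each coset is counted once.
  refine ⟨F.image fun g => (QuotientGroup.mk g : G ⧸ f.range).out, ?_⟩
  have hmem : ∀ g t : G, t⁻¹ * g ∈ f.range ↔ (QuotientGroup.mk t : G ⧸ f.range) = g :=
    fun g t => QuotientGroup.eq.symm
  ext i g
  rw [Finset.sum_apply, coeff_sum, Finsupp.finsetSum_apply]
  simp only [Pi.smul_apply, smul_eq_mul, coeff_single_mul_apply, one_mul,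
    coeff_mapDomain_translateComap, mul_inv_cancel_left, hmem]
  by_cases hg : g ∈ F
  · rw [Finset.sum_eq_single_of_mem _ (Finset.mem_image_of_mem _ hg), if_pos (by simp)]
    intro t ht hne
    rw [if_neg]
    intro h
    obtain ⟨g', -, rfl⟩ := Finset.mem_image.1 ht
    rw [QuotientGroup.out_eq'] at h
    exact hne (by rw [h])
  · rw [mem_piSupported.1 hF i g (by simpa using hg)]
    simp

/-- The matrix has entries in `k[H]`, so every coset component of a kernel element lies in the
kernel of `ψ`, whose generators therefore generate over `k[G]`. -/
lemma ker_fg_of_injective [Fintype ι] [Finite κ] (f : H →* G) (hf : Function.Injective f)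
    (hH : ∀ ψ : (ι → MonoidAlgebra k H) →ₗ[MonoidAlgebra k H] (κ → MonoidAlgebra k H),
      (LinearMap.ker ψ).FG)
    (φ : (ι → MonoidAlgebra k G) →ₗ[MonoidAlgebra k G] (κ → MonoidAlgebra k G))
    (m : ι → κ → MonoidAlgebra k H)
    (hm : ∀ x j, φ x j = ∑ i, x i * mapDomainRingHom k f (m i j)) :
    (LinearMap.ker φ).FG := by
  classical
  let ψ := Fintype.linearCombination (MonoidAlgebra k H) m
  have hψ : ∀ y j, ψ y j = ∑ i, y i * m i j := fun y j => by
    simp [ψ, Fintype.linearCombination_apply]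
  obtain ⟨T, hT⟩ := hH ψ
  let ρ : (ι → MonoidAlgebra k H) → (ι → MonoidAlgebra k G) :=
    fun y i => mapDomainRingHom k f (y i)
  have hφρ : ∀ y, ψ y = 0 → φ (ρ y) = 0 := by
    intro y hy
    ext1 j
    simp only [hm, ρ, ← map_mul, ← map_sum, ← hψ, hy, Pi.zero_apply, map_zero]
  have hρ : ∀ y, ψ y = 0 → ρ y ∈ Submodule.span (MonoidAlgebra k G) (ρ '' T) := by
    intro y hy
    have hy' : y ∈ Submodule.span (MonoidAlgebra k H) (T : Set (ι → MonoidAlgebra k H)) := by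
      rw [hT]; exact hy
    clear hy
    induction hy' using Submodule.span_induction with
    | mem y hy => exact Submodule.subset_span ⟨y, hy, rfl⟩
    | zero =>
      rw [show ρ 0 = 0 by ext1; simp [ρ]]
      exact Submodule.zero_mem _
    | add a b _ _ ha hb =>
      rw [show ρ (a + b) = ρ a + ρ b by
        ext1; simp only [ρ, Pi.add_apply, map_add]]
      exact Submodule.add_mem _ ha hb
    | smul c a _ ha =>
      rw [show ρ (c • a) = mapDomainRingHom k f c • ρ a by
        ext1; simp only [ρ, Pi.smul_apply, smul_eq_mul, map_mul]]
      exact Submodule.smul_mem _ _ ha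
  refine ⟨T.image ρ, le_antisymm (Submodule.span_le.2 ?_) fun x hx => ?_⟩
  · intro z hz
    obtain ⟨y, hy, rfl⟩ := Finset.mem_image.1 (Finset.mem_coe.1 hz)
    have : y ∈ LinearMap.ker ψ := hT ▸ Submodule.subset_span hy
    exact hφρ y this
  · rw [Finset.coe_image]
    obtain ⟨s, hs⟩ := exists_eq_sum_translate f hf x
    rw [hs]
    refine Submodule.sum_mem _ fun t _ => Submodule.smul_mem _ _ (hρ _ ?_)
    ext1 j
    rw [hψ]
    simp only [← translateComap_mul, ← map_sum, ← hm]
    rw [LinearMap.mem_ker.1 hx, Pi.zero_apply, map_zero, Pi.zero_apply]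

end MonoidAlgebra

namespace FreeGroup

variable {α : Type*}

lemma range_map_val_mono {s t : Set α} (h : s ⊆ t) :
    (map (Subtype.val : s → α)).range ≤ (map (Subtype.val : t → α)).range := by
  rintro _ ⟨x, rfl⟩
  refine ⟨map (Set.inclusion h) x, ?_⟩
  rw [map.comp]
  rfl

lemma exists_finite_mem_range_map (g : FreeGroup α) :
    ∃ s : Set α, s.Finite ∧ g ∈ (map (Subtype.val : s → α)).range := by
  induction g using FreeGroup.induction_on with
  | C1 => exact ⟨∅, Set.finite_empty, Subgroup.one_mem _⟩
  | of a => exact ⟨{a}, Set.finite_singleton a, of ⟨a, rfl⟩, map.of⟩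
  | inv_of a ih =>
    obtain ⟨s, hs, h⟩ := ih
    exact ⟨s, hs, Subgroup.inv_mem _ h⟩
  | mul x y hx hy =>
    obtain ⟨s, hs, hx⟩ := hx
    obtain ⟨t, ht, hy⟩ := hy
    exact ⟨s ∪ t, hs.union ht, Subgroup.mul_mem _ (range_map_val_mono Set.subset_union_left hx)
      (range_map_val_mono Set.subset_union_right hy)⟩

lemma exists_finite_subset_range_map (F : Finset (FreeGroup α)) :
    ∃ s : Set α, s.Finite ∧ ∀ g ∈ F, g ∈ (map (Subtype.val : s → α)).range := by
  choose s hs hg using exists_finite_mem_range_map (α := α)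
  exact ⟨⋃ g ∈ F, s g, F.finite_toSet.biUnion fun g _ => hs g, fun g hgF =>
    range_map_val_mono (Set.subset_biUnion_of_mem (u := s) (Finset.mem_coe.2 hgF)) (hg g)⟩

end FreeGroup

lemma MonoidAlgebra.ker_fg_of_freeGroup {k α ι κ : Type*} [CommRing k] [IsNoetherianRing k]
    [Fintype ι] [Finite κ]
    (φ : (ι → MonoidAlgebra k (FreeGroup α)) →ₗ[MonoidAlgebra k (FreeGroup α)]
      (κ → MonoidAlgebra k (FreeGroup α))) :
    (LinearMap.ker φ).FG := by
  classical
  cases nonempty_fintype κ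
  let v : ι → κ → MonoidAlgebra k (FreeGroup α) := fun i => φ fun j => if i = j then 1 else 0
  obtain ⟨s, hs, hF⟩ := FreeGroup.exists_finite_subset_range_map
    (Finset.univ.biUnion fun i => Finset.univ.biUnion fun j => (v i j).coeff.support)
  have := hs.to_subtype
  have hinj := FreeGroup.map_injective (Subtype.val_injective (p := (· ∈ s)))
  have hm : ∀ i j, ∃ m, mapDomainRingHom k (FreeGroup.map (Subtype.val : s → α)) m = v i j :=
    fun i j => mem_range_mapDomainRingHom (FreeGroup.map Subtype.val) hinj fun g hg => hF g <| by
      simp only [Finset.mem_biUnion, Finset.mem_univ, true_and]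
      exact ⟨i, j, hg⟩
  choose m hm using hm
  refine ker_fg_of_injective (FreeGroup.map Subtype.val) hinj (fun ψ => ker_fg_of_finite_rank ψ) φ m fun x j => ?_
  conv_lhs => rw [LinearMap.pi_apply_eq_sum_univ φ x]
  simp [hm, v]

/-- Every linear map between free left modules of finite rank has finitely generated kernel. -/
def FreeKernelsFG (A : Type*) [Ring A] : Prop :=
  ∀ (m n : ℕ) (φ : (Fin m → A) →ₗ[A] (Fin n → A)), (LinearMap.ker φ).FG

/-! ### Transfer to finite free extensions, matrices and opposite rings. -/

namespace FreeKernelsFG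

open Module MulOpposite

lemma ker_fg {A V W ι κ : Type*} [Ring A] [AddCommGroup V] [AddCommGroup W] [Module A V]
    [Module A W] [Finite ι] [Finite κ] (hA : FreeKernelsFG A) (b : Basis ι A V) (c : Basis κ A W)
    (φ : V →ₗ[A] W) : (LinearMap.ker φ).FG := by
  cases nonempty_fintype ι
  cases nonempty_fintype κ
  let e := (b.reindex (Fintype.equivFin ι)).equivFun
  let e' := (c.reindex (Fintype.equivFin κ)).equivFun
  have h := (hA _ _ (e'.toLinearMap ∘ₗ φ ∘ₗ e.symm.toLinearMap)).map e.symm.toLinearMap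
  convert h using 1
  ext x
  simp [Submodule.mem_map_equiv]

/-- Descent of finite generation of kernels along a ring over which everything is free of finite
rank. -/
lemma ker_fg_of_tower {A C W ι κ : Type*} [Ring A] [Ring C] [AddCommGroup W] [Module A C]
    [Module C W] [Module A W] [IsScalarTower A C C] [IsScalarTower A C W] [Finite ι] [Finite κ]
    (hA : FreeKernelsFG A) (b : Basis ι A C) (c : Basis κ A W) {n : ℕ}
    (φ : (Fin n → C) →ₗ[C] W) : (LinearMap.ker φ).FG :=
  .of_restrictScalars A (S := LinearMap.ker φ)
    (hA.ker_fg (Pi.basis fun _ : Fin n => b) c (φ.restrictScalars A))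

lemma of_basis {A C ι : Type*} [Ring A] [Ring C] [Module A C] [IsScalarTower A C C] [Finite ι]
    (hA : FreeKernelsFG A) (b : Basis ι A C) : FreeKernelsFG C :=
  fun _ n φ => hA.ker_fg_of_tower b (Pi.basis fun _ : Fin n => b) φ

lemma of_ringEquiv {A B : Type*} [Ring A] [Ring B] (hA : FreeKernelsFG A) (e : A ≃+* B) :
    FreeKernelsFG B := by
  let _ : Module A B := Module.compHom B (e : A →+* B)
  have : IsScalarTower A B B := ⟨fun a b c => mul_assoc (e a) b c⟩
  let e' : A ≃ₗ[A] B := { e with map_smul' := fun a b => map_mul e a b }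
  exact hA.of_basis ((Basis.singleton Unit A).map e')

lemma matrix {A ι : Type*} [Ring A] [Fintype ι] [DecidableEq ι] (hA : FreeKernelsFG A) :
    FreeKernelsFG (Matrix ι ι A) :=
  hA.of_basis (Matrix.stdBasis A ι ι)

lemma isLeftCoherentRing {A : Type*} [Ring A] (hA : FreeKernelsFG A) : IsLeftCoherentRing A :=
  ⟨inferInstance, fun _ φ => hA.ker_fg_of_tower (Basis.singleton Unit A) (Basis.singleton Unit A) φ⟩

lemma isRightCoherentRing {A : Type*} [Ring A] (hA : FreeKernelsFG Aᵐᵒᵖ) :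
    IsRightCoherentRing A :=
  let b := (Basis.singleton Unit Aᵐᵒᵖ).map (opLinearEquiv Aᵐᵒᵖ (M := A)).symm
  ⟨.of_basis b, fun _ φ => hA.ker_fg_of_tower (Basis.singleton Unit Aᵐᵒᵖ) b φ⟩

end FreeKernelsFG

lemma MonoidAlgebra.freeKernelsFG {k G : Type*} [CommRing k] [IsNoetherianRing k] [Group G]
    [IsFreeGroup G] : FreeKernelsFG (MonoidAlgebra k G) := by
  have h : FreeKernelsFG (MonoidAlgebra k (FreeGroup (IsFreeGroup.Generators G))) :=
    fun _ _ φ => ker_fg_of_freeGroup φ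
  exact h.of_ringEquiv (mapDomainRingEquiv k (IsFreeGroup.toFreeGroup G).symm)

/-- The opposite of `k[G]` is `kᵐᵒᵖ[Gᵐᵒᵖ]`, and inversion identifies `Gᵐᵒᵖ` with `G`. -/
lemma MonoidAlgebra.freeKernelsFG_op {k G : Type*} [CommRing k] [IsNoetherianRing k] [Group G]
    [IsFreeGroup G] : FreeKernelsFG (MonoidAlgebra k G)ᵐᵒᵖ := by
  have : IsNoetherianRing kᵐᵒᵖ := isNoetherianRing_of_ringEquiv k (RingEquiv.toOpposite k)
  have : IsFreeGroup Gᵐᵒᵖ := .ofMulEquiv (MulEquiv.inv' G)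
  exact (freeKernelsFG (k := kᵐᵒᵖ) (G := Gᵐᵒᵖ)).of_ringEquiv MonoidAlgebra.opRingEquiv.symm

theorem mainTheorem4 {k : Type*} [CommRing k] [IsNoetherianRing k]
    {G : Type*} [Group G] [IsFreeGroup G]
    {ι : Type*} [Fintype ι] [DecidableEq ι] :
    IsLeftCoherentRing (Matrix ι ι (MonoidAlgebra k G)) ∧
      IsRightCoherentRing (Matrix ι ι (MonoidAlgebra k G)) :=
  ⟨MonoidAlgebra.freeKernelsFG.matrix.isLeftCoherentRing,
    (MonoidAlgebra.freeKernelsFG_op.matrix.of_ringEquiv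
      RingEquiv.mopMatrix).isRightCoherentRing⟩
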